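/- For $i\ge 1$ let $\mathfrak{g}_i=\mathfrak{gl}(i,\mathbb{C})$, let $\mathcal{B}_i$ be its flag variety, i.e. the variety of all Borel (maximal solvable) subalgebras of $\mathfrak{g}_i$ with its Zariski topology, and let $K_i=GL(i-1,\mathbb{C})\times GL(1,\mathbb{C})\subset GL(i,\mathbb{C})$ be the group of invertible block diagonal matrices with an $(i-1)\times(i-1)$ block in the upper left corner and a $1\times 1$ block in the lower right corner, acting on $\mathcal{B}_i$ by conjugation. Let $n\ge 1$ and $\mathfrak{g}=\mathfrak{gl}(n,\mathbb{C})$. For a subalgebra $\mathfrak{m}\subset\mathfrak{g}$ and $i\le n$ let $\mathfrak{m}_i\subset\mathfrak{g}_i$ be the image of $\mathfrak{m}$ under the linear map sending a matrix to its upper left $i\times i$ corner. A sequence of closed $K_i$-orbits is a sequence $\mathcal{Q}=(Q_2,\dots,Q_n)$ in which each $Q_i\subset\mathcal{B}_i$ is a $K_i$-orbit that is closed in $\mathcal{B}_i$; put $$X_{\mathcal{Q}}=\{\mathfrak{b}\in\mathcal{B}_n:\ \mathfrak{b}_i\in Q_i \text{ for all } 2\le i\le n\}.$$ (1) For every sequence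 $\mathcal{Q}=(Q_2,\dots,Q_n)$ of closed $K_i$-orbits, $X_{\mathcal{Q}}$ consists of exactly one Borel subalgebra of $\mathfrak{g}$, and this Borel subalgebra contains the standard Cartan subalgebra of diagonal matrices. (2) If $\mathfrak{b}\subset\mathfrak{g}$ is a Borel subalgebra that contains the diagonal matrices, then $X_{\mathcal{Q}}=\{\mathfrak{b}\}$ for some sequence $\mathcal{Q}$ of closed $K_i$-orbits. -/

import Mathlib

/-! Borel subalgebras of `𝔤𝔩(n, ℂ)`, the flag variety, the groups `K_i`, and their closed orbits. -/

attribute [local instance] LieRing.ofAssociativeRing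

/-- The adjoint action `x ↦ g x g⁻¹` of `g ∈ GL(n, ℂ)` on `𝔤𝔩(n, ℂ)`. -/
noncomputable def adGL {n : ℕ} (g : GL (Fin n) ℂ) :
    Matrix (Fin n) (Fin n) ℂ ≃ₗ⁅ℂ⁆ Matrix (Fin n) (Fin n) ℂ :=
  Matrix.lieConj (g : Matrix (Fin n) (Fin n) ℂ) g.invertible

theorem adGL_apply {n : ℕ} (g : GL (Fin n) ℂ) (x : Matrix (Fin n) (Fin n) ℂ) :
    adGL g x = (g : Matrix (Fin n) (Fin n) ℂ) * x * (↑g⁻¹ : Matrix (Fin n) (Fin n) ℂ) := by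
  simp [adGL]

/-- A Borel subalgebra of `𝔤𝔩(n, ℂ)` is a maximal solvable Lie subalgebra. -/
def IsBorelSubalgebra {n : ℕ} (b : LieSubalgebra ℂ (Matrix (Fin n) (Fin n) ℂ)) : Prop :=
  Maximal (fun s : LieSubalgebra ℂ (Matrix (Fin n) (Fin n) ℂ) => LieAlgebra.IsSolvable s) b

/-- The flag variety `𝓑_n` of `𝔤𝔩(n, ℂ)`: its points are the Borel subalgebras. -/
@[ext]
structure FlagVariety (n : ℕ) where
  /-- the Borel subalgebra -/
  carrier : LieSubalgebra ℂ (Matrix (Fin n) (Fin n) ℂ)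
  isBorel : IsBorelSubalgebra carrier

/-- The image `Ad(g) b` of a subalgebra. -/
noncomputable def adMap {n : ℕ} (g : GL (Fin n) ℂ)
    (b : LieSubalgebra ℂ (Matrix (Fin n) (Fin n) ℂ)) :
    LieSubalgebra ℂ (Matrix (Fin n) (Fin n) ℂ) :=
  b.map (adGL g).toLieHom

theorem mem_adMap {n : ℕ} {g : GL (Fin n) ℂ}
    {b : LieSubalgebra ℂ (Matrix (Fin n) (Fin n) ℂ)} {x : Matrix (Fin n) (Fin n) ℂ} :
    x ∈ adMap g b ↔ ∃ y ∈ b, adGL g y = x := by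
  simp [adMap, LieSubalgebra.mem_map]

theorem adMap_one {n : ℕ} (b : LieSubalgebra ℂ (Matrix (Fin n) (Fin n) ℂ)) :
    adMap 1 b = b := by
  ext x
  simp [mem_adMap, adGL_apply]

theorem adMap_mul {n : ℕ} (g h : GL (Fin n) ℂ)
    (b : LieSubalgebra ℂ (Matrix (Fin n) (Fin n) ℂ)) :
    adMap (g * h) b = adMap g (adMap h b) := by
  ext x
  simp only [mem_adMap, adGL_apply]
  constructor
  · rintro ⟨y, hy, rfl⟩
    exact ⟨_, ⟨y, hy, rfl⟩, by simp only [mul_inv_rev, Units.val_mul]; noncomm_ring⟩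
  · rintro ⟨_, ⟨y, hy, rfl⟩, rfl⟩
    exact ⟨y, hy, by simp only [mul_inv_rev, Units.val_mul]; noncomm_ring⟩

theorem adMap_mono {n : ℕ} (g : GL (Fin n) ℂ)
    {b c : LieSubalgebra ℂ (Matrix (Fin n) (Fin n) ℂ)} (h : b ≤ c) : adMap g b ≤ adMap g c := by
  intro x hx
  obtain ⟨y, hy, rfl⟩ := mem_adMap.1 hx
  exact mem_adMap.2 ⟨y, h hy, rfl⟩

theorem isSolvable_adMap {n : ℕ} (g : GL (Fin n) ℂ)
    {b : LieSubalgebra ℂ (Matrix (Fin n) (Fin n) ℂ)} (h : LieAlgebra.IsSolvable b) :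
    LieAlgebra.IsSolvable (adMap g b) :=
  (LieAlgebra.solvable_iff_equiv_solvable ((adGL g).lieSubalgebraMap b)).1 h

theorem IsBorelSubalgebra.adMap {n : ℕ} (g : GL (Fin n) ℂ)
    {b : LieSubalgebra ℂ (Matrix (Fin n) (Fin n) ℂ)} (h : IsBorelSubalgebra b) :
    IsBorelSubalgebra (_root_.adMap g b) := by
  refine ⟨isSolvable_adMap g h.1, fun c hc hbc => ?_⟩
  have h1 : b ≤ _root_.adMap g⁻¹ c := by
    have := adMap_mono g⁻¹ hbc
    rwa [← adMap_mul, inv_mul_cancel, adMap_one] at this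
  have h2 := adMap_mono g (h.2 (isSolvable_adMap g⁻¹ hc) h1)
  rwa [← adMap_mul, mul_inv_cancel, adMap_one] at h2

/-- `GL(n, ℂ)` acts on the flag variety by conjugation, `g • b = Ad(g) b`. -/
noncomputable instance FlagVariety.instMulAction (n : ℕ) :
    MulAction (GL (Fin n) ℂ) (FlagVariety n) where
  smul g b := ⟨adMap g b.carrier, b.isBorel.adMap g⟩
  one_smul b := FlagVariety.ext (adMap_one b.carrier)
  mul_smul g h b := FlagVariety.ext (adMap_mul g h b.carrier)

/-- The Zariski topology on `GL(n, ℂ)`: the subspace topology from the affine space of all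
`n × n` matrices. Its closed sets are the zero sets in `GL(n, ℂ)` of families of polynomials in
the matrix entries. -/
@[reducible]
noncomputable def zariskiGL (n : ℕ) : TopologicalSpace (GL (Fin n) ℂ) :=
  TopologicalSpace.induced
    (fun g => (MvPolynomial.pointToPoint (fun p : Fin n × Fin n => g.1 p.1 p.2) :
      PrimeSpectrum (MvPolynomial (Fin n × Fin n) ℂ)))
    PrimeSpectrum.zariskiTopology

/-- The Zariski topology of the flag variety, as a quotient `GL(n, ℂ) / B`: a set `Z` is closed
if and only if `{g | Ad(g) b ∈ Z}` is Zariski closed in `GL(n, ℂ)` for every Borel subalgebra `b`.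
(The action is transitive, so that every `b` gives the same condition.) -/
noncomputable instance FlagVariety.instTopologicalSpace (n : ℕ) : TopologicalSpace (FlagVariety n) :=
  ⨆ b : FlagVariety n,
    TopologicalSpace.coinduced (fun g : GL (Fin n) ℂ => g • b) (zariskiGL n)

/-- `diag(1, …, 1, -1)`. -/
noncomputable def lastSign (i : ℕ) : Matrix (Fin i) (Fin i) ℂ :=
  Matrix.diagonal fun a => if (a : ℕ) + 1 = i then -1 else 1

theorem commute_lastSign_iff {i : ℕ} (g : Matrix (Fin i) (Fin i) ℂ) :
    Commute g (lastSign i) ↔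
      ∀ a b : Fin i, ¬ ((a : ℕ) + 1 = i ↔ (b : ℕ) + 1 = i) → g a b = 0 := by
  have key : Commute g (lastSign i) ↔ ∀ a b : Fin i,
      g a b * (if (b : ℕ) + 1 = i then -1 else 1) =
        (if (a : ℕ) + 1 = i then -1 else 1) * g a b := by
    rw [commute_iff_eq, ← Matrix.ext_iff]
    simp only [lastSign, Matrix.mul_diagonal, Matrix.diagonal_mul]
  rw [key]
  refine forall₂_congr fun a b => ?_
  by_cases ha : (a : ℕ) + 1 = i <;> by_cases hb : (b : ℕ) + 1 = i <;>
    simp [ha, hb, self_eq_neg, neg_eq_self]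

/-- The group `K_i = GL(i - 1, ℂ) × GL(1, ℂ) ⊆ GL(i, ℂ)` of invertible block diagonal matrices with
an `(i - 1) × (i - 1)` block in the upper left corner and a `1 × 1` block in the lower right
corner: an entry `(a, b)` vanishes when exactly one of `a`, `b` is the last index. -/
def blockK (i : ℕ) : Subgroup (GL (Fin i) ℂ) where
  carrier := {g | ∀ a b : Fin i, ¬ ((a : ℕ) + 1 = i ↔ (b : ℕ) + 1 = i) → g.1 a b = 0}
  one_mem' := (commute_lastSign_iff _).1 (Commute.one_left _)
  mul_mem' {g h} hg hh := (commute_lastSign_iff _).1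
    (((commute_lastSign_iff g.1).2 hg).mul_left ((commute_lastSign_iff h.1).2 hh))
  inv_mem' {g} hg := (commute_lastSign_iff _).1
    (Commute.units_inv_left (u := g) ((commute_lastSign_iff g.1).2 hg))

/-- `Q ⊆ 𝓑_i` is a closed `K_i`-orbit. -/
def IsClosedKOrbit {i : ℕ} (Q : Set (FlagVariety i)) : Prop :=
  (∃ b : FlagVariety i, Q = MulAction.orbit (blockK i) b) ∧ IsClosed Q

/-- `(Q_2, …, Q_n)` is a sequence of closed `K_i`-orbits (the values of `Q` at other indices are
irrelevant). -/
def IsClosedOrbitSequence (n : ℕ) (Q : (i : ℕ) → Set (FlagVariety i)) : Prop :=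
  ∀ i : ℕ, 2 ≤ i → i ≤ n → IsClosedKOrbit (Q i)

/-- The projection `π_i : 𝔤𝔩(n, ℂ) → 𝔤𝔩(i, ℂ)`, `x ↦ x_i`, onto the upper left `i × i` corner. -/
def cornerProj {i n : ℕ} (h : i ≤ n) :
    Matrix (Fin n) (Fin n) ℂ →ₗ[ℂ] Matrix (Fin i) (Fin i) ℂ where
  toFun x := x.submatrix (Fin.castLE h) (Fin.castLE h)
  map_add' _ _ := rfl
  map_smul' _ _ := rfl

/-- The image `m_i = π_i(m)` of a Lie subalgebra `m`. -/
def cornerImage {i n : ℕ} (h : i ≤ n) (m : LieSubalgebra ℂ (Matrix (Fin n) (Fin n) ℂ)) :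
    Submodule ℂ (Matrix (Fin i) (Fin i) ℂ) :=
  m.toSubmodule.map (cornerProj h)

/-- `X_Q = {b ∈ 𝓑_n : b_i ∈ Q_i for 2 ≤ i ≤ n}`; `b_i ∈ Q_i` means that the subspace `b_i` of
`𝔤𝔩(i, ℂ)` is (the underlying subspace of) a Borel subalgebra which belongs to `Q_i`. -/
def orbitTower (n : ℕ) (Q : (i : ℕ) → Set (FlagVariety i)) : Set (FlagVariety n) :=
  {b | ∀ i : ℕ, 2 ≤ i → ∀ h : i ≤ n,
    ∃ c ∈ Q i, cornerImage h b.carrier = c.carrier.toSubmodule}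

/-- The standard Cartan subalgebra of diagonal matrices in `𝔤𝔩(n, ℂ)`. -/
def diagonalCartan (n : ℕ) : LieSubalgebra ℂ (Matrix (Fin n) (Fin n) ℂ) where
  carrier := {x | x.IsDiag}
  zero_mem' := Matrix.isDiag_zero
  add_mem' hx hy := Matrix.IsDiag.add hx hy
  smul_mem' c _ hx := Matrix.IsDiag.smul c hx
  lie_mem' := by
    intro x y hx hy
    have hx' := hx.diagonal_diag
    have hy' := hy.diagonal_diag
    change Matrix.IsDiag ⁅x, y⁆
    rw [← hx', ← hy', Ring.lie_def, Matrix.diagonal_mul_diagonal, Matrix.diagonal_mul_diagonal,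
      Matrix.diagonal_sub]
    exact Matrix.isDiag_diagonal _

open Topology

/-! Write `b_r` for the matrices triangular for the order on the indices given by an injective `r`,
and θ for `lastSign i`, whose centralizer in `GL(i, ℂ)` is `K_i`. By Lie's theorem each `b_r` is a
Borel subalgebra, all Borel subalgebras are conjugate, and those containing the diagonal matrices
are exactly the `b_r`.

The closed `K_i`-orbits are exactly the orbits of the `b_r`. Such an orbit is closed because
membership of `g • b_r` is a polynomial condition on `g⁻¹ θ g`
(`smul_triangularFlag_mem_orbit_iff`). Conversely, every point of an orbit degenerates along a
one-parameter subgroup of `K_i` to a `K_i`-translate of some `b_r`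
(`IsClosedKOrbit.exists_eq_orbit`).

Part (1) is an induction on `n`. Let `Q_{n+1} = K • b_r` and let `b'` be the unique point of the
tower for `n`. Taking corners sends `k • b_r` to `k' • b_{r'}`, where `k'` is the corner of `k` and
`r'` the restriction of `r`. Every element of `GL(n, ℂ)` is such a `k'`, so some point of the orbit
lies over `b'`. An element of `K` is `r`-triangular if and only if its corner is `r'`-triangular, so
`k` stabilizes `b_r` exactly when `k'` stabilizes `b_{r'}`, and that point is unique. For part (2),
the corners of `b_r` are again of this form and their orbits are closed, so `b_r` lies in a tower,
which by (1) has no other point. -/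

theorem mem_adMap_iff {n : ℕ} {g : GL (Fin n) ℂ}
    {b : LieSubalgebra ℂ (Matrix (Fin n) (Fin n) ℂ)} {x : Matrix (Fin n) (Fin n) ℂ} :
    x ∈ adMap g b ↔ (↑g⁻¹ : Matrix (Fin n) (Fin n) ℂ) * x * (g : Matrix (Fin n) (Fin n) ℂ) ∈ b := by
  rw [mem_adMap]
  constructor
  · rintro ⟨y, hy, rfl⟩
    rw [adGL_apply]
    simpa [← mul_assoc] using hy
  · intro h
    refine ⟨_, h, ?_⟩
    rw [adGL_apply]
    simp [← mul_assoc]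

/-- Inclusions between Borel subalgebras are equalities. -/
theorem FlagVariety.eq_of_le {n : ℕ} {b c : FlagVariety n} (h : b.carrier ≤ c.carrier) : b = c :=
  FlagVariety.ext (le_antisymm h (b.isBorel.2 c.isBorel.1 h))

/-! ### Triangular subalgebras: solvability and conjugates containing the diagonal -/

/-- The subalgebra of matrices that are triangular with respect to the (pre)order on the indices
given by `r`. -/
def triangularSubalgebra {n : ℕ} (r : Fin n → ℕ) :
    LieSubalgebra ℂ (Matrix (Fin n) (Fin n) ℂ) where
  carrier := {x | x.BlockTriangular r}
  zero_mem' := Matrix.blockTriangular_zero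
  add_mem' hx hy := hx.add hy
  smul_mem' c x hx := fun a b h => by simp [hx h]
  lie_mem' {x y} hx hy := by
    change Matrix.BlockTriangular ⁅x, y⁆ r
    rw [Ring.lie_def]
    exact (Matrix.BlockTriangular.mul hx hy).sub (Matrix.BlockTriangular.mul hy hx)

theorem diagonalCartan_le_triangularSubalgebra {n : ℕ} (r : Fin n → ℕ) :
    diagonalCartan n ≤ triangularSubalgebra r := by
  intro x hx a b hab
  exact hx (by rintro rfl; exact lt_irrefl _ hab)

theorem BlockTriangular.mul_apply_self {n : ℕ} {r : Fin n → ℕ} (hr : Function.Injective r)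
    {x y : Matrix (Fin n) (Fin n) ℂ} (hx : x.BlockTriangular r) (hy : y.BlockTriangular r)
    (a : Fin n) : (x * y) a a = x a a * y a a := by
  rw [Matrix.mul_apply]
  refine Finset.sum_eq_single a (fun c _ hc => ?_) (by simp)
  rcases lt_or_gt_of_ne (hr.ne hc) with h | h
  · rw [hx h, zero_mul]
  · rw [hy h, mul_zero]

/-- The triangular matrices `x` with `x a b = 0` unless `r a + k ≤ r b`. -/
def triangularFiltration {n : ℕ} (r : Fin n → ℕ) (k : ℕ) :
    LieIdeal ℂ (triangularSubalgebra r) where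
  carrier := {x | ∀ a b, r b < r a + k → x.1 a b = 0}
  zero_mem' := fun _ _ _ => rfl
  add_mem' {x y} hx hy := fun a b h => by
    change x.1 a b + y.1 a b = 0
    rw [hx a b h, hy a b h, add_zero]
  smul_mem' c x hx := fun a b h => by
    change c • x.1 a b = 0
    rw [hx a b h, smul_zero]
  lie_mem {x y} hy := fun a b h => by
    change (x.1 * y.1 - y.1 * x.1) a b = 0
    rw [Matrix.sub_apply, Matrix.mul_apply, Matrix.mul_apply,
      Finset.sum_eq_zero, Finset.sum_eq_zero, sub_zero]
    · intro c _
      by_cases hc : r c < r a + k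
      · rw [hy a c hc, zero_mul]
      · rw [x.2 (show r b < r c by omega), mul_zero]
    · intro c _
      by_cases hc : r c < r a
      · rw [x.2 hc, zero_mul]
      · rw [hy c b (by omega), mul_zero]

/-- For `k = 0` the diagonal of a commutator cancels, by injectivity of `r`; for `k ≥ 1` products
already lie in degree `2 * k ≥ k + 1`. -/
theorem lie_triangularFiltration_le {n : ℕ} {r : Fin n → ℕ} (hr : Function.Injective r) (k : ℕ) :
    ⁅triangularFiltration r k, triangularFiltration r k⁆ ≤ triangularFiltration r (k + 1) := by
  rw [LieSubmodule.lie_le_iff]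
  intro x hx y hy a b h
  change (x.1 * y.1 - y.1 * x.1) a b = 0
  rcases Nat.eq_zero_or_pos k with rfl | hk
  · rcases (show r b ≤ r a by omega).lt_or_eq with h | h
    · exact ((Matrix.BlockTriangular.mul x.2 y.2).sub (Matrix.BlockTriangular.mul y.2 x.2)) h
    · obtain rfl := hr h
      rw [Matrix.sub_apply, BlockTriangular.mul_apply_self hr x.2 y.2,
        BlockTriangular.mul_apply_self hr y.2 x.2, mul_comm, sub_self]
  · have key : ∀ u v : triangularSubalgebra r, u ∈ triangularFiltration r k →
        v ∈ triangularFiltration r k → (u.1 * v.1) a b = 0 := by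
      intro u v hu hv
      rw [Matrix.mul_apply]
      refine Finset.sum_eq_zero fun c _ => ?_
      by_cases hc : r c < r a + k
      · rw [hu a c hc, zero_mul]
      · rw [hv c b (by omega), mul_zero]
    rw [Matrix.sub_apply, key x y hx hy, key y x hy hx, sub_zero]

theorem isSolvable_triangularSubalgebra {n : ℕ} {r : Fin n → ℕ} (hr : Function.Injective r) :
    LieAlgebra.IsSolvable (triangularSubalgebra r) := by
  have key : ∀ k, LieAlgebra.derivedSeries ℂ (triangularSubalgebra r) k ≤
      triangularFiltration r k := by
    intro k
    induction k with
    | zero => exact fun x _ a b h => x.2 h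
    | succ k ih =>
      rw [LieAlgebra.derivedSeries_def, LieAlgebra.derivedSeriesOfIdeal_succ]
      exact (LieSubmodule.mono_lie ih ih).trans (lie_triangularFiltration_le hr k)
  refine LieAlgebra.IsSolvable.mk (R := ℂ) (k := Finset.univ.sup r + 1) ?_
  rw [eq_bot_iff]
  intro x hx
  rw [LieSubmodule.mem_bot]
  apply Subtype.ext
  ext a b
  refine key _ hx a b ?_
  have := Finset.le_sup (f := r) (Finset.mem_univ b)
  omega

/-- If `Ad(g)` of a triangular algebra contains the diagonal matrices, then it lies in a triangular
algebra for a permuted order. -/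
theorem exists_adMap_le_triangularSubalgebra {n : ℕ} {r : Fin n → ℕ}
    (hr : Function.Injective r) {g : GL (Fin n) ℂ}
    (h : diagonalCartan n ≤ adMap g (triangularSubalgebra r)) :
    ∃ ρ : Fin n → Fin n, Function.Injective ρ ∧
      adMap g (triangularSubalgebra r) ≤ triangularSubalgebra (r ∘ ρ) ∧
      ∀ a l, r l < r (ρ a) → g.1 a l = 0 := by
  -- The entries of `g⁻¹ E_aa g`, which is triangular because `E_aa` is diagonal.
  have h1 : ∀ a k l, r l < r k → (g⁻¹).1 k a * g.1 a l = 0 := by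
    intro a k l hkl
    have h2 := mem_adMap_iff.1 (h (show Matrix.single a a (1 : ℂ) ∈ diagonalCartan n by
      rw [← Matrix.diagonal_single]; exact Matrix.isDiag_diagonal _))
    have h3 := h2 hkl
    simpa [Matrix.mul_apply, Matrix.single_apply, Finset.sum_ite_eq, ite_and] using h3
  have hg : ∀ a b, ∑ l, g.1 a l * (g⁻¹).1 l b = if a = b then 1 else 0 := by
    intro a b
    rw [← Matrix.mul_apply, Units.mul_inv, Matrix.one_apply]
  -- `ρ a` will be the `r`-largest index at which column `a` of `g⁻¹` is nonzero; by `h1`, row `a`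
  -- of `g` then vanishes at all smaller indices.
  have h2 : ∀ a, ∃ k, (g⁻¹).1 k a ≠ 0 ∧ ∀ l, r k < r l → (g⁻¹).1 l a = 0 := by
    intro a
    have hne : (Finset.univ.filter fun k => (g⁻¹).1 k a ≠ 0).Nonempty := by
      by_contra hcon
      rw [Finset.not_nonempty_iff_eq_empty, Finset.filter_eq_empty_iff] at hcon
      have := hg a a
      rw [Finset.sum_eq_zero] at this
      · simp at this
      · intro l hl
        rw [not_not.1 (hcon hl), mul_zero]
    obtain ⟨k, hk, hmax⟩ := Finset.exists_max_image _ r hne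
    refine ⟨k, by simpa using hk, fun l hl => ?_⟩
    by_contra hcon
    exact absurd (hmax l (by simpa using hcon)) (not_le.2 hl)
  choose ρ hρ1 hρ2 using h2
  have h3 : ∀ a l, r l < r (ρ a) → g.1 a l = 0 := fun a l hl =>
    (mul_eq_zero.1 (h1 a _ l hl)).resolve_left (hρ1 a)
  -- In the sum for `(g g⁻¹) a b` only the term `l = ρ a` survives, which forces `ρ` to be
  -- injective.
  have h4 : ∀ a b, ρ a = ρ b →
      g.1 a (ρ a) * (g⁻¹).1 (ρ a) b = if a = b then 1 else 0 := by
    intro a b hab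
    rw [← hg a b, eq_comm]
    refine Finset.sum_eq_single _ (fun l _ hl => ?_) (by simp)
    rcases lt_or_gt_of_ne (hr.ne hl) with hlt | hlt
    · rw [h3 a l hlt, zero_mul]
    · rw [hρ2 b l (hab ▸ hlt), mul_zero]
  refine ⟨ρ, fun a b hab => ?_, fun x hx a b hab => ?_, h3⟩
  · by_contra hne
    have h5 := h4 a b hab
    rw [if_neg hne] at h5
    have h6 := h4 a a rfl
    rw [if_pos rfl] at h6
    rcases mul_eq_zero.1 h5 with h7 | h7
    · rw [h7, zero_mul] at h6
      exact zero_ne_one h6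
    · exact hρ1 b (hab ▸ h7)
  · obtain ⟨y, hy, rfl⟩ := mem_adMap.1 hx
    rw [adGL_apply, Matrix.mul_apply]
    refine Finset.sum_eq_zero fun l _ => ?_
    by_cases hl : r (ρ b) < r l
    · rw [hρ2 b l hl, mul_zero]
    rw [Matrix.mul_apply, Finset.sum_eq_zero, zero_mul]
    intro k _
    by_cases hk : r k < r (ρ a)
    · rw [h3 a k hk, zero_mul]
    · have hlk : r l < r k := by
        simp only [Function.comp_apply] at hab
        omega
      rw [hy hlk, mul_zero]

/-! ### Lie's theorem, conjugacy and normalizers of Borel subalgebras -/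

/-- A finite-dimensional module over a solvable Lie algebra has an adapted basis. -/
theorem exists_linearIndependent_lie_mem_span (L : Type*) [LieRing L] [LieAlgebra ℂ L]
    [LieAlgebra.IsSolvable L] (n : ℕ) :
    ∀ (V : Type) [AddCommGroup V] [Module ℂ V] [LieRingModule L V] [LieModule ℂ L V]
      [Module.Finite ℂ V], Module.finrank ℂ V = n →
      ∃ v : Fin n → V, LinearIndependent ℂ v ∧
        ∀ (x : L) (i : Fin n), ∃ c : Fin n → ℂ, (∀ j, i < j → c j = 0) ∧
          ⁅x, v i⁆ = ∑ j, c j • v j := by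
  induction n with
  | zero => exact fun V _ _ _ _ _ _ => ⟨Fin.elim0, linearIndependent_empty_type, fun _ i => i.elim0⟩
  | succ n ih =>
    intro V _ _ _ _ _ hV
    have : Nontrivial V := Module.nontrivial_of_finrank_pos (R := ℂ) (by omega)
    -- A common eigenvector `w` comes first in the basis; the rest is lifted from the quotient by
    -- its span.
    obtain ⟨χ, hχ⟩ := LieModule.exists_nontrivial_weightSpace_of_isSolvable ℂ L V
    obtain ⟨⟨w, hw⟩, hw0⟩ := exists_ne (0 : LieModule.weightSpace V χ)
    rw [LieModule.mem_weightSpace] at hw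
    have hw0 : w ≠ 0 := fun h => hw0 (Subtype.ext h)
    let N : LieSubmodule ℂ L V :=
      { toSubmodule := ℂ ∙ w
        lie_mem := by
          intro x m hm
          obtain ⟨c, rfl⟩ := Submodule.mem_span_singleton.1 hm
          change ⁅x, c • w⁆ ∈ ℂ ∙ w
          rw [lie_smul, hw]
          exact Submodule.smul_mem _ _ (Submodule.smul_mem _ _ (Submodule.mem_span_singleton_self w)) }
    have hmem : ∀ m, (LieSubmodule.Quotient.mk m : V ⧸ N) = 0 → ∃ c : ℂ, c • w = m := by
      intro m hm
      rw [LieSubmodule.Quotient.mk_eq_zero'] at hm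
      exact Submodule.mem_span_singleton.1 hm
    have hN : Module.finrank ℂ (V ⧸ N) = n := by
      have h1 := Submodule.finrank_quotient_add_finrank (ℂ ∙ w)
      rw [finrank_span_singleton hw0, hV] at h1
      exact Nat.succ_injective h1
    have : Module.Finite ℂ (V ⧸ N) := inferInstanceAs (Module.Finite ℂ (V ⧸ (ℂ ∙ w)))
    obtain ⟨v, hv, hvL⟩ := ih (V ⧸ N) hN
    choose u hu using fun i => LieSubmodule.Quotient.surjective_mk' N (v i)
    refine ⟨Fin.cons w u, ?_, ?_⟩
    · rw [Fintype.linearIndependent_iff] at hv ⊢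
      intro c hc
      rw [Fin.sum_univ_succ] at hc
      simp only [Fin.cons_zero, Fin.cons_succ] at hc
      have h1 := congrArg (LieSubmodule.Quotient.mk' N) hc
      have hw1 : LieSubmodule.Quotient.mk' N w = 0 :=
        LieSubmodule.Quotient.mk_eq_zero'.2 (Submodule.mem_span_singleton_self w)
      simp only [map_add, map_smul, map_sum, hw1, hu, smul_zero, zero_add, map_zero] at h1
      have h2 := hv _ h1
      simp only [h2, zero_smul, Finset.sum_const_zero, add_zero, smul_eq_zero, hw0, or_false] at hc
      exact fun i => Fin.cases hc h2 i
    · intro x i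
      refine Fin.cases ?_ (fun i => ?_) i
      · refine ⟨Pi.single 0 (χ x), fun j hj => Pi.single_eq_of_ne hj.ne' _, ?_⟩
        rw [Fin.sum_univ_succ]
        simp [hw]
      · obtain ⟨c, hc, hcx⟩ := hvL x i
        have h1 : LieSubmodule.Quotient.mk' N (⁅x, u i⁆ - ∑ j, c j • u j) = 0 := by
          simp only [map_sub, map_sum, map_smul, LieModuleHom.map_lie, hu, hcx, sub_self]
        obtain ⟨d, hd⟩ := hmem _ h1
        refine ⟨Fin.cons d c, fun j hj => ?_, ?_⟩
        · cases j using Fin.cases with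
          | zero => exact absurd hj (Fin.not_lt_zero _)
          | succ j => exact hc j (Fin.succ_lt_succ_iff.1 hj)
        · rw [Fin.sum_univ_succ]
          simp only [Fin.cons_zero, Fin.cons_succ, hd]
          abel

/-- **Lie's theorem** for matrices. -/
theorem exists_le_adMap_triangularSubalgebra {n : ℕ}
    (s : LieSubalgebra ℂ (Matrix (Fin n) (Fin n) ℂ)) (hs : LieAlgebra.IsSolvable s) :
    ∃ g : GL (Fin n) ℂ, s ≤ adMap g (triangularSubalgebra Fin.val) := by
  obtain ⟨v, hv, hvs⟩ := exists_linearIndependent_lie_mem_span s n (Fin n → ℂ) (by simp)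
  have hu : IsUnit (Matrix.of v).transpose := by
    rw [Matrix.isUnit_transpose, ← Matrix.linearIndependent_rows_iff_isUnit]
    exact hv
  refine ⟨hu.unit, fun x hx => ?_⟩
  choose c hc hcx using fun i => hvs ⟨x, hx⟩ i
  rw [mem_adMap]
  refine ⟨Matrix.of fun j i => c i j, fun a b h => hc b a h, ?_⟩
  rw [adGL_apply, Units.mul_inv_eq_iff_eq_mul]
  ext a i
  have := congrFun (hcx i) a
  change (x.mulVec (v i)) a = _ at this
  rw [IsUnit.unit_spec, Matrix.mul_apply, Matrix.mul_apply]
  simp only [Finset.sum_apply, Pi.smul_apply, smul_eq_mul, Matrix.mulVec, dotProduct] at this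
  simp only [Matrix.transpose_apply, Matrix.of_apply]
  rw [this]
  exact Finset.sum_congr rfl fun j _ => mul_comm _ _

/-- A solvable `c` above the triangular algebra also contains the diagonal matrices, so it lies in a
triangular algebra for another order. Matrix units in the smaller algebra show that the two orders
agree. -/
theorem isBorelSubalgebra_triangularSubalgebra {n : ℕ} {r : Fin n → ℕ}
    (hr : Function.Injective r) : IsBorelSubalgebra (triangularSubalgebra r) := by
  refine ⟨isSolvable_triangularSubalgebra hr, fun c hc hle => ?_⟩
  obtain ⟨g, hg⟩ := exists_le_adMap_triangularSubalgebra c hc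
  obtain ⟨ρ, hρ, hgρ, -⟩ := exists_adMap_le_triangularSubalgebra Fin.val_injective
    ((diagonalCartan_le_triangularSubalgebra r).trans (hle.trans hg))
  have hr' : ∀ a b, r a ≤ r b → (ρ a).val ≤ (ρ b).val := by
    intro a b hab
    by_contra hlt
    have := hgρ (hg (hle (Matrix.blockTriangular_single hab (1 : ℂ)))) (not_le.1 hlt)
    simp at this
  intro x hx a b hab
  refine hgρ (hg hx) (lt_of_le_of_ne (hr' b a hab.le) fun h => ?_)
  have := hρ (Fin.ext h)
  rw [this] at hab
  exact lt_irrefl _ hab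

/-- The Borel subalgebra of matrices that are triangular with respect to the total order on the
indices given by `r`. -/
def triangularFlag {n : ℕ} (r : Fin n → ℕ) (hr : Function.Injective r) : FlagVariety n :=
  ⟨triangularSubalgebra r, isBorelSubalgebra_triangularSubalgebra hr⟩

theorem exists_smul_triangularFlag {n : ℕ} {r : Fin n → ℕ} (hr : Function.Injective r)
    (b : FlagVariety n) : ∃ g : GL (Fin n) ℂ, b = g • triangularFlag r hr := by
  have key : ∀ b : FlagVariety n, ∃ g : GL (Fin n) ℂ,
      b = g • triangularFlag Fin.val Fin.val_injective := fun b =>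
    (exists_le_adMap_triangularSubalgebra b.carrier b.isBorel.1).imp
      fun g hg => FlagVariety.eq_of_le hg
  obtain ⟨g, rfl⟩ := key b
  obtain ⟨h, hh⟩ := key (triangularFlag r hr)
  exact ⟨g * h⁻¹, by rw [hh, mul_smul, inv_smul_smul]⟩

theorem blockTriangular_inv {n : ℕ} {r : Fin n → ℕ} {g : GL (Fin n) ℂ}
    (h : g.1.BlockTriangular r) : (g⁻¹).1.BlockTriangular r := by
  have := g.invertible
  have h1 := Matrix.blockTriangular_inv_of_blockTriangular h
  rwa [← Matrix.coe_units_inv] at h1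

/-- The normalizer of a triangular Borel subalgebra is the group of triangular matrices. -/
theorem smul_triangularFlag_eq_iff {n : ℕ} {r : Fin n → ℕ} (hr : Function.Injective r)
    {g : GL (Fin n) ℂ} :
    g • triangularFlag r hr = triangularFlag r hr ↔ g.1.BlockTriangular r := by
  constructor
  · intro h
    have hc : adMap g (triangularSubalgebra r) = triangularSubalgebra r :=
      congrArg FlagVariety.carrier h
    obtain ⟨ρ, hρ, hgρ, hg⟩ := exists_adMap_le_triangularSubalgebra hr
      (hc ▸ diagonalCartan_le_triangularSubalgebra r)
    rw [hc] at hgρ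
    have hmono : ∀ a b, r a < r b → r (ρ a) < r (ρ b) := by
      intro a b hab
      refine lt_of_le_of_ne ?_ fun h => hab.ne (congrArg r (hρ (hr h)))
      by_contra hlt
      have := hgρ (Matrix.blockTriangular_single hab.le (1 : ℂ)) (not_le.1 hlt)
      simp at this
    -- A strictly increasing self-map of a well-ordered set never moves a point down.
    have hle : ∀ m a, r a = m → r a ≤ r (ρ a) := by
      intro m
      induction m using Nat.strong_induction_on with
      | _ m ih =>
        rintro a rfl
        by_contra hlt
        have hlt := not_le.1 hlt
        exact absurd (ih _ hlt _ rfl) (not_le.2 (hmono _ _ hlt))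
    exact fun a l hl => hg a l (hl.trans_le (hle _ a rfl))
  · intro h
    refine FlagVariety.eq_of_le fun x hx => ?_
    obtain ⟨y, hy, rfl⟩ := mem_adMap.1 hx
    rw [adGL_apply]
    exact (h.mul hy).mul (blockTriangular_inv h)

theorem exists_eq_triangularFlag {n : ℕ} {b : FlagVariety n}
    (hb : diagonalCartan n ≤ b.carrier) :
    ∃ (r : Fin n → ℕ) (hr : Function.Injective r), b = triangularFlag r hr := by
  obtain ⟨g, rfl⟩ := exists_smul_triangularFlag Fin.val_injective b
  obtain ⟨ρ, hρ, hgρ, -⟩ := exists_adMap_le_triangularSubalgebra Fin.val_injective hb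
  exact ⟨Fin.val ∘ ρ, Fin.val_injective.comp hρ, FlagVariety.eq_of_le hgρ⟩

/-! ### Orbits of coordinate Borel subalgebras are closed -/

theorem mem_blockK_iff {i : ℕ} {g : GL (Fin i) ℂ} :
    g ∈ blockK i ↔ Commute g.1 (lastSign i) :=
  (commute_lastSign_iff g.1).symm

theorem lastSign_mul_self (i : ℕ) : lastSign i * lastSign i = 1 := by
  rw [lastSign, Matrix.diagonal_mul_diagonal, ← Matrix.diagonal_one]
  congr 1
  ext a
  split_ifs <;> simp

theorem isClosed_zariskiGL_iff {n : ℕ} {Z : Set (GL (Fin n) ℂ)} :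
    IsClosed[zariskiGL n] Z ↔ ∃ S : Set (MvPolynomial (Fin n × Fin n) ℂ),
      ∀ g : GL (Fin n) ℂ, g ∈ Z ↔ ∀ f ∈ S, MvPolynomial.eval (fun p => g.1 p.1 p.2) f = 0 := by
  have key : ∀ (S : Set (MvPolynomial (Fin n × Fin n) ℂ)) (x : Fin n × Fin n → ℂ),
      (MvPolynomial.pointToPoint x : PrimeSpectrum (MvPolynomial (Fin n × Fin n) ℂ)) ∈
        PrimeSpectrum.zeroLocus S ↔ ∀ f ∈ S, MvPolynomial.eval x f = 0 := by
    intro S x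
    rw [PrimeSpectrum.mem_zeroLocus]
    exact forall₂_congr fun f _ => MvPolynomial.mem_vanishingIdeal_singleton_iff x f
  rw [isClosed_induced_iff]
  constructor
  · rintro ⟨C, hC, rfl⟩
    obtain ⟨S, rfl⟩ := (PrimeSpectrum.isClosed_iff_zeroLocus C).1 hC
    exact ⟨S, fun g => key S _⟩
  · rintro ⟨S, hS⟩
    exact ⟨_, PrimeSpectrum.isClosed_zeroLocus S, Set.ext fun g => (key S _).trans (hS g).symm⟩

theorem FlagVariety.isClosed_iff {n : ℕ} {Z : Set (FlagVariety n)} :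
    IsClosed Z ↔ ∀ b : FlagVariety n,
      IsClosed[zariskiGL n] {g : GL (Fin n) ℂ | g • b ∈ Z} := by
  change IsClosed[⨆ b : FlagVariety n, TopologicalSpace.coinduced _ (zariskiGL n)] Z ↔ _
  rw [isClosed_iSup_iff]
  exact forall_congr' fun b => isClosed_coinduced

theorem det_ne_zero_of_blockTriangular {n : ℕ} {r : Fin n → ℕ} (hr : Function.Injective r)
    {x : Matrix (Fin n) (Fin n) ℂ} (hx : x.BlockTriangular r) (hd : ∀ a, x a a ≠ 0) :
    x.det ≠ 0 := by
  rw [hx.det, Finset.prod_ne_zero_iff]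
  intro m hm
  obtain ⟨a, -, rfl⟩ := Finset.mem_image.1 hm
  have : Subsingleton {i // r i = r a} :=
    ⟨fun i j => Subtype.ext (hr (i.2.trans j.2.symm))⟩
  rw [Matrix.det_eq_elem_of_subsingleton _ ⟨a, rfl⟩]
  exact hd a

/-- The `K`-orbit of a coordinate Borel subalgebra, in terms of the involution `g⁻¹ θ g`. -/
theorem smul_triangularFlag_mem_orbit_iff {i : ℕ} {r : Fin i → ℕ} (hr : Function.Injective r)
    (g : GL (Fin i) ℂ) :
    g • triangularFlag r hr ∈ MulAction.orbit (blockK i) (triangularFlag r hr) ↔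
      ((g⁻¹).1 * lastSign i * g.1).BlockTriangular r ∧
        ∀ a, ((g⁻¹).1 * lastSign i * g.1) a a = lastSign i a a := by
  have hθ : (lastSign i).BlockTriangular r := Matrix.blockTriangular_diagonal _
  constructor
  · rintro ⟨k, hk⟩
    have hk1 : k.1⁻¹ • g • triangularFlag r hr = triangularFlag r hr := by
      rw [← hk]
      exact inv_smul_smul k.1 _
    rw [smul_smul, smul_triangularFlag_eq_iff] at hk1
    set p := k.1⁻¹ * g with hp
    have hg : g = k.1 * p := by rw [hp, mul_inv_cancel_left]
    have hkθ : (k.1⁻¹).1 * lastSign i * k.1.1 = lastSign i := by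
      rw [mul_assoc, ← (mem_blockK_iff.1 k.2).eq, ← mul_assoc, Units.inv_mul, one_mul]
    have hgθ : (g⁻¹).1 * lastSign i * g.1 = (p⁻¹).1 * lastSign i * p.1 := by
      rw [hg, mul_inv_rev, Units.val_mul, Units.val_mul]
      calc _ = (p⁻¹).1 * ((k.1⁻¹).1 * lastSign i * k.1.1) * p.1 := by noncomm_ring
        _ = _ := by rw [hkθ]
    have hpi := blockTriangular_inv hk1
    rw [hgθ]
    refine ⟨(hpi.mul hθ).mul hk1, fun a => ?_⟩
    rw [BlockTriangular.mul_apply_self hr (hpi.mul hθ) hk1, BlockTriangular.mul_apply_self hr hpi hθ,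
      mul_right_comm, ← BlockTriangular.mul_apply_self hr hpi hk1, Units.inv_mul,
      Matrix.one_apply_eq, one_mul]
  · rintro ⟨hu, hd⟩
    set u := (g⁻¹).1 * lastSign i * g.1 with hu_def
    have huu : u * u = 1 := by
      calc u * u = (g⁻¹).1 * (lastSign i * (g.1 * (g⁻¹).1) * lastSign i) * g.1 := by
            rw [hu_def]; noncomm_ring
        _ = 1 := by rw [Units.mul_inv, mul_one, lastSign_mul_self, mul_one, Units.inv_mul]
    -- As `u` and θ are involutions, `p = 1 + u θ` satisfies `p θ = u p`, so `g p` commutes with θ.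
    -- Its diagonal entries are `1 + 1`, so `p` is invertible.
    have hp : (1 + u * lastSign i).BlockTriangular r :=
      Matrix.blockTriangular_one.add (hu.mul hθ)
    have hdet : (1 + u * lastSign i).det ≠ 0 := by
      refine det_ne_zero_of_blockTriangular hr hp fun a => ?_
      rw [Matrix.add_apply, BlockTriangular.mul_apply_self hr hu hθ, hd a,
        ← BlockTriangular.mul_apply_self hr hθ hθ, lastSign_mul_self, Matrix.one_apply_eq]
      norm_num
    let p : GL (Fin i) ℂ := Matrix.GeneralLinearGroup.mkOfDetNeZero _ hdet
    have hk : g * p ∈ blockK i := by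
      rw [mem_blockK_iff, commute_iff_eq]
      change g.1 * (1 + u * lastSign i) * lastSign i = lastSign i * (g.1 * (1 + u * lastSign i))
      have h1 : (1 + u * lastSign i) * lastSign i = u * (1 + u * lastSign i) := by
        rw [add_mul, mul_add, mul_assoc, lastSign_mul_self, ← mul_assoc, huu]
        simp [add_comm]
      have h2 : g.1 * u = lastSign i * g.1 := by
        rw [hu_def, ← mul_assoc, ← mul_assoc, Units.mul_inv, one_mul]
      rw [mul_assoc, h1, ← mul_assoc, h2, mul_assoc]
    have hpT : p • triangularFlag r hr = triangularFlag r hr :=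
      (smul_triangularFlag_eq_iff hr).2 hp
    refine ⟨⟨g * p, hk⟩, ?_⟩
    change (g * p) • triangularFlag r hr = _
    rw [mul_smul, hpT]

theorem isClosed_orbit_triangularFlag {i : ℕ} {r : Fin i → ℕ} (hr : Function.Injective r) :
    IsClosed (MulAction.orbit (blockK i) (triangularFlag r hr)) := by
  rw [FlagVariety.isClosed_iff]
  intro b
  obtain ⟨h, rfl⟩ := exists_smul_triangularFlag hr b
  rw [isClosed_zariskiGL_iff]
  -- `Y` is the generic matrix times `h`. The adjugate replaces the inverse, so the entries of `P`
  -- are polynomials, equal to those of the conjugated θ up to the nonzero factor `det (g * h)`.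
  let Y : Matrix (Fin i) (Fin i) (MvPolynomial (Fin i × Fin i) ℂ) :=
    Matrix.of (fun a b => MvPolynomial.X (a, b)) * h.1.map MvPolynomial.C
  let P := Y.adjugate * (lastSign i).map MvPolynomial.C * Y
  have hY : ∀ g : GL (Fin i) ℂ,
      (MvPolynomial.eval fun p : Fin i × Fin i => g.1 p.1 p.2).mapMatrix Y = (g * h).1 := by
    intro g
    rw [map_mul, Units.val_mul]
    congr 1 <;> ext a b <;> simp
  have hadj : ∀ g : GL (Fin i) ℂ, g.1.adjugate = g.1.det • (g⁻¹).1 := by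
    intro g
    rw [← mul_one g.1.adjugate, ← Units.mul_inv g, ← mul_assoc, Matrix.adjugate_mul,
      Matrix.smul_mul, one_mul]
  have hP : ∀ (g : GL (Fin i) ℂ) a b, MvPolynomial.eval (fun p => g.1 p.1 p.2) (P a b) =
      (g * h).1.det * (((g * h)⁻¹).1 * lastSign i * (g * h).1) a b := by
    intro g a b
    change ((MvPolynomial.eval fun p : Fin i × Fin i => g.1 p.1 p.2).mapMatrix P) a b = _
    have hθ : (MvPolynomial.eval fun p : Fin i × Fin i => g.1 p.1 p.2).mapMatrix
        ((lastSign i).map MvPolynomial.C) = lastSign i := by ext a b; simp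
    rw [map_mul, map_mul, RingHom.map_adjugate, hY, hθ, hadj, Matrix.smul_mul, Matrix.smul_mul,
      Matrix.smul_apply, smul_eq_mul]
  have hdet : ∀ g : GL (Fin i) ℂ,
      MvPolynomial.eval (fun p : Fin i × Fin i => g.1 p.1 p.2) Y.det = (g * h).1.det := by
    intro g
    rw [RingHom.map_det, hY g]
  refine ⟨{f | (∃ a b, r b < r a ∧ f = P a b) ∨
    ∃ a, f = P a a - Y.det * MvPolynomial.C (lastSign i a a)}, fun g => ?_⟩
  have hne : (g * h).1.det ≠ 0 := (Matrix.isUnits_det_units (g * h)).ne_zero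
  rw [Set.mem_ofPred_eq, smul_smul, smul_triangularFlag_mem_orbit_iff]
  constructor
  · rintro ⟨h1, h2⟩ f (⟨a, b, hab, rfl⟩ | ⟨a, rfl⟩)
    · rw [hP, h1 hab, mul_zero]
    · rw [map_sub, map_mul, hP, hdet, MvPolynomial.eval_C, h2, sub_self]
  · intro hf
    refine ⟨fun a b hab => ?_, fun a => ?_⟩
    · have := hf _ (Or.inl ⟨a, b, hab, rfl⟩)
      rw [hP] at this
      exact (mul_eq_zero.1 this).resolve_left hne
    · have := hf _ (Or.inr ⟨a, rfl⟩)
      rw [map_sub, map_mul, hP, hdet, MvPolynomial.eval_C, sub_eq_zero] at this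
      exact mul_left_cancel₀ hne this

/-! ### Closed orbits contain coordinate Borel subalgebras -/

/-- A subset of `GL(n, ℂ)` that is Zariski closed contains the limit at `t = 0` of every
polynomial curve which it contains for `t ≠ 0`. -/
theorem mem_of_isClosed_zariskiGL {n : ℕ} {Z : Set (GL (Fin n) ℂ)} (hZ : IsClosed[zariskiGL n] Z)
    (γ : ℂ → GL (Fin n) ℂ) (p : Fin n → Fin n → Polynomial ℂ)
    (hp : ∀ t a b, (γ t).1 a b = (p a b).eval t) (hγ : ∀ t, t ≠ 0 → γ t ∈ Z) : γ 0 ∈ Z := by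
  obtain ⟨S, hS⟩ := isClosed_zariskiGL_iff.1 hZ
  rw [hS]
  intro f hf
  let F : Polynomial ℂ := MvPolynomial.aeval (fun q : Fin n × Fin n => p q.1 q.2) f
  have hF : ∀ t, F.eval t = MvPolynomial.eval (fun q => (γ t).1 q.1 q.2) f := by
    intro t
    simp only [hp]
    change Polynomial.evalRingHom t (MvPolynomial.aeval _ f) = _
    rw [MvPolynomial.aeval_def, MvPolynomial.hom_eval₂]
    have : (Polynomial.evalRingHom t).comp (algebraMap ℂ (Polynomial ℂ)) = RingHom.id ℂ := by
      ext; simp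
    rw [this]
    rfl
  -- The factor `X` kills the one uncontrolled value, at `t = 0`.
  have hF0 : Polynomial.X * F = 0 := by
    refine Polynomial.funext fun t => ?_
    rcases eq_or_ne t 0 with rfl | ht
    · simp
    · rw [Polynomial.eval_mul, hF, (hS _).1 (hγ t ht) f hf, mul_zero, Polynomial.eval_zero]
  rw [← hF, (mul_eq_zero.1 hF0).resolve_left Polynomial.X_ne_zero, Polynomial.eval_zero]

/-- The invertible diagonal matrix with nonzero diagonal entries `d`. -/
noncomputable def diagonalGL {n : ℕ} (d : Fin n → ℂ) (hd : ∀ a, d a ≠ 0) : GL (Fin n) ℂ :=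
  Matrix.GeneralLinearGroup.mkOfDetNeZero (Matrix.diagonal d)
    (by rw [Matrix.det_diagonal]; exact Finset.prod_ne_zero_iff.2 fun a _ => hd a)

/-- The permutation matrix of a transposition. -/
noncomputable def swapGL {n : ℕ} (i j : Fin n) : GL (Fin n) ℂ :=
  have h : (Matrix.of fun a b => if a = Equiv.swap i j b then (1 : ℂ) else 0) *
      (Matrix.of fun a b => if a = Equiv.swap i j b then (1 : ℂ) else 0) = 1 := by
    ext a b
    simp [Matrix.mul_apply, Matrix.one_apply]
  ⟨_, _, h, h⟩

theorem mul_swapGL_apply {n : ℕ} (i j : Fin n) (x : Matrix (Fin n) (Fin n) ℂ) (a b : Fin n) :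
    (x * (swapGL i j).1) a b = x a (Equiv.swap i j b) := by
  simp [swapGL, Matrix.mul_apply]

theorem swapGL_mul_apply {n : ℕ} (i j : Fin n) (x : Matrix (Fin n) (Fin n) ℂ) (a b : Fin n) :
    ((swapGL i j).1 * x) a b = x (Equiv.swap i j a) b := by
  have : ∀ c, (a = Equiv.swap i j c) ↔ Equiv.swap i j a = c := fun c =>
    ⟨fun h => by rw [h, Equiv.swap_apply_self], fun h => by rw [← h, Equiv.swap_apply_self]⟩
  simp [swapGL, Matrix.mul_apply, this]

theorem swapGL_smul_triangularFlag {n : ℕ} (i j : Fin n) {r : Fin n → ℕ}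
    (hr : Function.Injective r) :
    (swapGL i j)⁻¹ • triangularFlag r hr =
      triangularFlag (r ∘ Equiv.swap i j) (hr.comp (Equiv.swap i j).injective) := by
  refine FlagVariety.eq_of_le fun x hx a b hab => ?_
  obtain ⟨y, hy, rfl⟩ := mem_adMap.1 hx
  rw [adGL_apply, inv_inv, mul_swapGL_apply]
  change ((swapGL i j).1 * y) a _ = 0
  rw [swapGL_mul_apply]
  exact hy hab

/-- Every flag is spanned by vectors of which only one has a nonzero last coordinate. -/
theorem exists_smul_eq_smul_of_last_row {m : ℕ} (g : GL (Fin (m + 1)) ℂ) :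
    ∃ (g' : GL (Fin (m + 1)) ℂ) (j : Fin (m + 1)),
      g' • triangularFlag (n := m + 1) Fin.val Fin.val_injective =
        g • triangularFlag (n := m + 1) Fin.val Fin.val_injective ∧
      g'.1 (Fin.last m) j ≠ 0 ∧ ∀ k, k ≠ j → g'.1 (Fin.last m) k = 0 := by
  have hne : (Finset.univ.filter fun k => g.1 (Fin.last m) k ≠ 0).Nonempty := by
    by_contra hcon
    rw [Finset.not_nonempty_iff_eq_empty, Finset.filter_eq_empty_iff] at hcon
    have h1 : (g.1 * (g⁻¹).1) (Fin.last m) (Fin.last m) = 1 := by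
      rw [Units.mul_inv, Matrix.one_apply_eq]
    rw [Matrix.mul_apply, Finset.sum_eq_zero] at h1
    · exact zero_ne_one h1
    · intro l hl
      rw [not_not.1 (hcon hl), zero_mul]
  obtain ⟨j, hj, hmin⟩ := Finset.exists_min_image _ Fin.val hne
  have hj : g.1 (Fin.last m) j ≠ 0 := by simpa using hj
  have hmin : ∀ k < j, g.1 (Fin.last m) k = 0 := by
    intro k hk
    by_contra hcon
    exact absurd (hmin k (by simpa using hcon)) (not_le.2 hk)
  -- Column `j` is the first with nonzero last entry. Right multiplication by `1 - q` clears the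
  -- last entries of the later columns, and being triangular it preserves the flag.
  let q : Matrix (Fin (m + 1)) (Fin (m + 1)) ℂ := Matrix.of fun a b =>
    if a = j ∧ j < b then g.1 (Fin.last m) b / g.1 (Fin.last m) j else 0
  have hq : ∀ b, (g.1 * q) (Fin.last m) b = if j < b then g.1 (Fin.last m) b else 0 := by
    intro b
    rw [Matrix.mul_apply, Finset.sum_eq_single j]
    · by_cases hb : j < b
      · simp only [q, Matrix.of_apply, hb, and_self, if_true]
        field_simp
      · simp [q, hb]
    · intro c _ hc
      simp [q, hc]
    · simp
  have hqT : (1 - q).BlockTriangular Fin.val := by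
    refine Matrix.blockTriangular_one.sub fun a b hab => ?_
    refine if_neg ?_
    rintro ⟨rfl, h⟩
    exact absurd hab (not_lt.2 h.le)
  have hdet : (1 - q).det ≠ 0 := by
    refine det_ne_zero_of_blockTriangular Fin.val_injective hqT fun a => ?_
    have : q a a = 0 := if_neg (by rintro ⟨rfl, h⟩; exact lt_irrefl _ h)
    rw [Matrix.sub_apply, this, Matrix.one_apply_eq, sub_zero]
    exact one_ne_zero
  let p : GL (Fin (m + 1)) ℂ := Matrix.GeneralLinearGroup.mkOfDetNeZero _ hdet
  have hgp : ∀ b, (g * p).1 (Fin.last m) b =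
      g.1 (Fin.last m) b - if j < b then g.1 (Fin.last m) b else 0 := by
    intro b
    change (g.1 * (1 - q)) (Fin.last m) b = _
    rw [mul_sub, mul_one, Matrix.sub_apply, hq]
  refine ⟨g * p, j, ?_, ?_, fun k hk => ?_⟩
  · rw [mul_smul, (smul_triangularFlag_eq_iff Fin.val_injective (g := p)).2 hqT]
  · rwa [hgp, if_neg (lt_irrefl j), sub_zero]
  · rw [hgp]
    rcases lt_or_gt_of_ne hk with h | h
    · rw [if_neg h.not_gt, hmin k h, sub_zero]
    · rw [if_pos h, sub_self]

/-- Scaling all but the last entry of the column `j` by `t`. -/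
def scaleColumn {m : ℕ} (g : Matrix (Fin (m + 1)) (Fin (m + 1)) ℂ) (j : Fin (m + 1)) (t : ℂ) :
    Matrix (Fin (m + 1)) (Fin (m + 1)) ℂ :=
  Matrix.of fun a b => if b = j ∧ a ≠ Fin.last m then t * g a b else g a b

/-- The last row forces a kernel vector to vanish at `j`, and the other columns are unchanged. This
covers `t = 0`, so the limit of the curve is still invertible. -/
theorem det_scaleColumn_ne_zero {m : ℕ} {g : Matrix (Fin (m + 1)) (Fin (m + 1)) ℂ}
    (hg : g.det ≠ 0) {j : Fin (m + 1)} (hj : g (Fin.last m) j ≠ 0)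
    (hk : ∀ k, k ≠ j → g (Fin.last m) k = 0) (t : ℂ) : (scaleColumn g j t).det ≠ 0 := by
  intro h
  obtain ⟨v, hv, hv0⟩ := Matrix.exists_mulVec_eq_zero_iff.2 h
  have hvj : v j = 0 := by
    have h1 := congrFun hv0 (Fin.last m)
    rw [Matrix.mulVec, dotProduct, Finset.sum_eq_single j] at h1
    · simp only [scaleColumn, Matrix.of_apply, ne_eq, not_true, and_false, if_false,
        Pi.zero_apply] at h1
      exact (mul_eq_zero.1 h1).resolve_left hj
    · intro k _ hkj
      simp [scaleColumn, hk k hkj]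
    · simp
  refine hg (Matrix.exists_mulVec_eq_zero_iff.1 ⟨v, hv, ?_⟩)
  rw [← hv0]
  ext a
  simp only [Matrix.mulVec, dotProduct]
  refine Finset.sum_congr rfl fun k _ => ?_
  rcases eq_or_ne k j with rfl | hkj
  · rw [hvj, mul_zero, mul_zero]
  · simp [scaleColumn, hkj]

/-- A closed `K`-orbit contains a coordinate Borel subalgebra. -/
theorem IsClosedKOrbit.exists_eq_orbit {i : ℕ} (hi : 0 < i) {Q : Set (FlagVariety i)}
    (hQ : IsClosedKOrbit Q) : ∃ (r : Fin i → ℕ) (hr : Function.Injective r),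
      Q = MulAction.orbit (blockK i) (triangularFlag r hr) := by
  obtain ⟨m, rfl⟩ := Nat.exists_eq_succ_of_ne_zero hi.ne'
  obtain ⟨⟨b, rfl⟩, hcl⟩ := hQ
  obtain ⟨g, hgb⟩ := exists_smul_triangularFlag Fin.val_injective b
  obtain ⟨g', j, hg', hj, hk⟩ := exists_smul_eq_smul_of_last_row g
  have hdet : g'.1.det ≠ 0 := (Matrix.isUnits_det_units g').ne_zero
  let γ : ℂ → GL (Fin (m + 1)) ℂ := fun t =>
    Matrix.GeneralLinearGroup.mkOfDetNeZero _ (det_scaleColumn_ne_zero hdet hj hk t)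
  have hγ : ∀ t a c, (γ t).1 a c = if c = j ∧ a ≠ Fin.last m then t * g'.1 a c else g'.1 a c :=
    fun _ _ _ => rfl
  have h0 : γ 0 ∈ {g | g • triangularFlag (n := m + 1) Fin.val Fin.val_injective ∈
      MulAction.orbit (blockK (m + 1)) b} := by
    refine mem_of_isClosed_zariskiGL (FlagVariety.isClosed_iff.1 hcl _) γ
      (fun a c => if c = j ∧ a ≠ Fin.last m then Polynomial.X * Polynomial.C (g'.1 a c)
        else Polynomial.C (g'.1 a c)) (fun t a c => ?_) (fun t ht => ?_)
    · rw [hγ]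
      split_ifs
      · rw [Polynomial.eval_mul, Polynomial.eval_X, Polynomial.eval_C]
      · rw [Polynomial.eval_C]
    -- For `t ≠ 0` the curve is `k g' s`, with `k = diag(t, …, t, 1)` in `K` and `s` a diagonal
    -- matrix fixing the flag, so it stays in the orbit of `b`.
    · let k := diagonalGL (fun a : Fin (m + 1) => if a = Fin.last m then 1 else t)
        (fun a => by split_ifs <;> simp [ht])
      let s := diagonalGL (fun a : Fin (m + 1) => if a = j then 1 else t⁻¹)
        (fun a => by split_ifs <;> simp [ht])
      have hkK : k ∈ blockK (m + 1) := mem_blockK_iff.2 (Matrix.commute_diagonal _ _)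
      have hs : s • triangularFlag (n := m + 1) Fin.val Fin.val_injective =
          triangularFlag (n := m + 1) Fin.val Fin.val_injective :=
        (smul_triangularFlag_eq_iff Fin.val_injective).2 (Matrix.blockTriangular_diagonal _)
      have hkγ : γ t = k * g' * s := by
        apply Units.ext
        ext a c
        change _ = (Matrix.diagonal (fun a : Fin (m + 1) => if a = Fin.last m then 1 else t) * g'.1 *
          Matrix.diagonal (fun a : Fin (m + 1) => if a = j then 1 else t⁻¹)) a c
        rw [hγ, Matrix.mul_diagonal, Matrix.diagonal_mul]
        rcases eq_or_ne a (Fin.last m) with rfl | ha <;> rcases eq_or_ne c j with rfl | hc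
        · simp
        · simp [hk c hc]
        · simp [ha]
        · simp only [hc, ha, false_and, if_false]
          field_simp
      refine ⟨⟨k, hkK⟩, ?_⟩
      change k • b = γ t • _
      rw [hkγ, mul_smul, hs, mul_smul, hg', hgb]
  -- At `t = 0` column `j` is a multiple of the last basis vector and the other columns have last
  -- entry zero; moving column `j` to the end makes the matrix block diagonal.
  have hK : γ 0 * swapGL j (Fin.last m) ∈ blockK (m + 1) := by
    intro a c hac
    change ((γ 0).1 * (swapGL j (Fin.last m)).1) a c = 0
    rw [mul_swapGL_apply, hγ, zero_mul]
    have hlast : ∀ a : Fin (m + 1), (a : ℕ) + 1 = m + 1 ↔ a = Fin.last m := by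
      intro a
      rw [Fin.ext_iff, Fin.val_last]
      omega
    rw [hlast, hlast] at hac
    by_cases ha : a = Fin.last m
    · have hc : c ≠ Fin.last m := fun hc => hac (iff_of_true ha hc)
      rw [if_neg (by simp [ha]), ha, hk]
      intro h
      rw [Equiv.swap_apply_eq_iff, Equiv.swap_apply_left] at h
      exact hc h
    · have hc : c = Fin.last m := by tauto
      rw [hc, Equiv.swap_apply_right, if_pos ⟨rfl, ha⟩]
  refine ⟨_, Fin.val_injective.comp (Equiv.swap j (Fin.last m)).injective, ?_⟩
  rw [← swapGL_smul_triangularFlag, eq_comm, MulAction.orbit_eq_iff]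
  obtain ⟨k, hkb⟩ := h0
  refine ⟨⟨_, hK⟩⁻¹ * k, ?_⟩
  simp only [mul_smul, hkb]
  rw [inv_smul_eq_iff]
  rw [Subgroup.mk_smul, mul_smul, smul_inv_smul]

/-! ### Upper left corners and the action of `K` -/

theorem cornerImage_triangularSubalgebra {i n : ℕ} (h : i ≤ n) (r : Fin n → ℕ) :
    cornerImage h (triangularSubalgebra r) =
      (triangularSubalgebra (r ∘ Fin.castLE h)).toSubmodule := by
  ext z
  constructor
  · rintro ⟨x, hx, rfl⟩ a b hab
    exact hx hab
  · intro hz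
    refine ⟨Matrix.of fun a b => if hab : (a : ℕ) < i ∧ (b : ℕ) < i then
      z ⟨a, hab.1⟩ ⟨b, hab.2⟩ else 0, fun a b hab => ?_, ?_⟩
    · simp only [Matrix.of_apply]
      split_ifs with h1
      · exact hz (show r (Fin.castLE h ⟨b, h1.2⟩) < r (Fin.castLE h ⟨a, h1.1⟩) from hab)
      · rfl
    · ext a b
      exact dif_pos (⟨a.2, b.2⟩ : (a : ℕ) < i ∧ (b : ℕ) < i)

theorem cornerImage_cornerImage {i n : ℕ} (h : i ≤ n)
    (b : LieSubalgebra ℂ (Matrix (Fin (n + 1)) (Fin (n + 1)) ℂ)) :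
    (cornerImage n.le_succ b).map (cornerProj h) = cornerImage (h.trans n.le_succ) b := by
  rw [cornerImage, cornerImage, ← Submodule.map_comp]
  rfl

theorem cornerImage_self {n : ℕ} (b : LieSubalgebra ℂ (Matrix (Fin n) (Fin n) ℂ)) :
    cornerImage le_rfl b = b.toSubmodule :=
  Submodule.map_id _

theorem commute_lastSign_succ_iff {n : ℕ} {x : Matrix (Fin (n + 1)) (Fin (n + 1)) ℂ} :
    Commute x (lastSign (n + 1)) ↔
      ∀ a : Fin n, x a.castSucc (Fin.last n) = 0 ∧ x (Fin.last n) a.castSucc = 0 := by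
  rw [commute_lastSign_iff]
  constructor
  · intro h a
    have ha : ¬ (a : ℕ) + 1 = n + 1 := by have := a.2; omega
    exact ⟨h _ _ (by simpa using ha), h _ _ (by simpa using ha)⟩
  · intro h a b hab
    cases a using Fin.lastCases with
    | last =>
      cases b using Fin.lastCases with
      | last => simp at hab
      | cast b => exact (h b).2
    | cast a =>
      cases b using Fin.lastCases with
      | last => exact (h a).1
      | cast b =>
        have := a.2
        have := b.2
        simp only [Fin.val_castSucc] at hab
        omega

theorem cornerProj_mul_of_commute {n : ℕ} {k : Matrix (Fin (n + 1)) (Fin (n + 1)) ℂ}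
    (hk : Commute k (lastSign (n + 1))) (x : Matrix (Fin (n + 1)) (Fin (n + 1)) ℂ) :
    cornerProj n.le_succ (k * x) = cornerProj n.le_succ k * cornerProj n.le_succ x := by
  ext a b
  change (k * x) a.castSucc b.castSucc = _
  rw [Matrix.mul_apply, Fin.sum_univ_castSucc, (commute_lastSign_succ_iff.1 hk a).1, zero_mul,
    add_zero, Matrix.mul_apply]
  rfl

theorem cornerProj_mul_of_commute' {n : ℕ} {k : Matrix (Fin (n + 1)) (Fin (n + 1)) ℂ}
    (hk : Commute k (lastSign (n + 1))) (x : Matrix (Fin (n + 1)) (Fin (n + 1)) ℂ) :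
    cornerProj n.le_succ (x * k) = cornerProj n.le_succ x * cornerProj n.le_succ k := by
  ext a b
  change (x * k) a.castSucc b.castSucc = _
  rw [Matrix.mul_apply, Fin.sum_univ_castSucc, (commute_lastSign_succ_iff.1 hk b).2, mul_zero,
    add_zero, Matrix.mul_apply]
  rfl

theorem cornerProj_one {i n : ℕ} (h : i ≤ n) : cornerProj h 1 = 1 :=
  Matrix.submatrix_one _ (Fin.castLE_injective h)

/-- The off-diagonal entries in the last row and column vanish, so the position of the last index in
the order is irrelevant. This transfers stabilizers between sizes `n` and `n + 1`. -/
theorem blockTriangular_iff_of_commute {n : ℕ} {x : Matrix (Fin (n + 1)) (Fin (n + 1)) ℂ}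
    (hx : Commute x (lastSign (n + 1))) (r : Fin (n + 1) → ℕ) :
    x.BlockTriangular r ↔
      (cornerProj n.le_succ x).BlockTriangular (r ∘ Fin.castLE n.le_succ) := by
  refine ⟨fun h a b hab => h hab, fun h a b hab => ?_⟩
  cases a using Fin.lastCases with
  | last =>
    cases b using Fin.lastCases with
    | last => exact absurd hab (lt_irrefl _)
    | cast b => exact (commute_lastSign_succ_iff.1 hx b).2
  | cast a =>
    cases b using Fin.lastCases with
    | last => exact (commute_lastSign_succ_iff.1 hx a).1
    | cast b => exact h (i := a) (j := b) hab

/-- The upper left block of an element of `K`. -/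
noncomputable def blockK.corner {n : ℕ} (k : blockK (n + 1)) : GL (Fin n) ℂ where
  val := cornerProj n.le_succ k.1.1
  inv := cornerProj n.le_succ (k.1⁻¹).1
  val_inv := by
    rw [← cornerProj_mul_of_commute (mem_blockK_iff.1 k.2), Units.mul_inv, cornerProj_one]
  inv_val := by
    rw [← cornerProj_mul_of_commute (mem_blockK_iff.1 (inv_mem k.2)), Units.inv_mul,
      cornerProj_one]

theorem blockK.exists_corner_eq {n : ℕ} (h : GL (Fin n) ℂ) :
    ∃ k : blockK (n + 1), blockK.corner k = h := by
  let f : Matrix (Fin n) (Fin n) ℂ → Matrix (Fin (n + 1)) (Fin (n + 1)) ℂ := fun x =>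
    Matrix.of fun a b => Fin.lastCases (motive := fun _ => ℂ)
      (Fin.lastCases (motive := fun _ => ℂ) 1 (fun _ => 0) b)
      (fun a => Fin.lastCases (motive := fun _ => ℂ) 0 (fun b => x a b) b) a
  have hf : ∀ x y, x * y = 1 → f x * f y = 1 := by
    intro x y hxy
    ext a b
    rw [Matrix.mul_apply, Fin.sum_univ_castSucc]
    cases a using Fin.lastCases with
    | last => cases b using Fin.lastCases <;> simp [f, ne_of_gt]
    | cast a =>
      cases b using Fin.lastCases with
      | last => simp [f, ne_of_lt]
      | cast b =>
        have := congrFun (congrFun hxy a) b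
        rw [Matrix.mul_apply] at this
        simp [f, this, Matrix.one_apply]
  refine ⟨⟨⟨f h.1, f (h⁻¹).1, hf _ _ (Units.mul_inv h), hf _ _ (Units.inv_mul h)⟩, ?_⟩, ?_⟩
  · rw [mem_blockK_iff, commute_lastSign_succ_iff]
    intro a
    simp [f]
  · apply Units.ext
    ext a b
    change f h.1 a.castSucc b.castSucc = _
    simp [f]

/-- Taking corners is not multiplicative in general, but it is when one factor is block diagonal;
hence it intertwines conjugation by `k` with conjugation by its corner. -/
theorem cornerImage_smul_triangularFlag {n : ℕ} (k : blockK (n + 1)) {r : Fin (n + 1) → ℕ}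
    (hr : Function.Injective r) :
    cornerImage n.le_succ (k • triangularFlag r hr).carrier =
      (blockK.corner k • triangularFlag (r ∘ Fin.castLE n.le_succ)
        (hr.comp (Fin.castLE_injective _))).carrier.toSubmodule := by
  have hconj : ∀ x, cornerProj n.le_succ (adGL k.1 x) =
      adGL (blockK.corner k) (cornerProj n.le_succ x) := by
    intro x
    rw [adGL_apply, adGL_apply, mul_assoc, cornerProj_mul_of_commute (mem_blockK_iff.1 k.2),
      cornerProj_mul_of_commute' (mem_blockK_iff.1 (inv_mem k.2)), ← mul_assoc]
    rfl
  have hc := cornerImage_triangularSubalgebra n.le_succ r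
  ext z
  constructor
  · rintro ⟨x, hx, rfl⟩
    obtain ⟨y, hy, rfl⟩ := mem_adMap.1 hx
    refine mem_adMap.2 ⟨cornerProj n.le_succ y, ?_, (hconj y).symm⟩
    exact hc.le ⟨y, hy, rfl⟩
  · intro hz
    obtain ⟨w, hw, rfl⟩ := mem_adMap.1 hz
    obtain ⟨y, hy, rfl⟩ := hc.ge hw
    exact ⟨adGL k.1 y, mem_adMap.2 ⟨y, hy, rfl⟩, hconj y⟩

/-! ### The induction on the size and the main theorem -/

theorem FlagVariety.subsingleton_of_le_one {n : ℕ} (hn : n ≤ 1) :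
    Subsingleton (FlagVariety n) := by
  have : Subsingleton (Fin n) := Fin.subsingleton_iff_le_one.2 hn
  have key : ∀ b : FlagVariety n, b = triangularFlag Fin.val Fin.val_injective := fun b =>
    FlagVariety.eq_of_le fun x _ a c hac => absurd hac (by
      rw [Subsingleton.elim a c]; exact lt_irrefl _)
  exact ⟨fun b c => (key b).trans (key c).symm⟩

theorem exists_orbitTower_eq_singleton (n : ℕ) (Q : (i : ℕ) → Set (FlagVariety i))
    (hQ : IsClosedOrbitSequence n Q) :
    ∃ b : FlagVariety n, orbitTower n Q = {b} ∧ diagonalCartan n ≤ b.carrier := by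
  induction n with
  | zero =>
    have := FlagVariety.subsingleton_of_le_one zero_le_one
    refine ⟨triangularFlag Fin.val Fin.val_injective, ?_, diagonalCartan_le_triangularSubalgebra _⟩
    exact Set.eq_singleton_iff_unique_mem.2
      ⟨fun i hi h => by omega, fun _ _ => Subsingleton.elim _ _⟩
  | succ n ih =>
    -- Size one is separate: orbit sequences start at index 2, so `Q 1` carries no information.
    rcases Nat.eq_zero_or_pos n with rfl | hn
    · have := FlagVariety.subsingleton_of_le_one le_rfl
      refine ⟨triangularFlag Fin.val Fin.val_injective, ?_,
        diagonalCartan_le_triangularSubalgebra _⟩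
      exact Set.eq_singleton_iff_unique_mem.2
        ⟨fun i hi h => by omega, fun _ _ => Subsingleton.elim _ _⟩
    obtain ⟨b', hb', hdiag⟩ := ih fun i h2 hi => hQ i h2 (hi.trans n.le_succ)
    obtain ⟨r, hr, hQr⟩ := (hQ (n + 1) (by omega) le_rfl).exists_eq_orbit n.succ_pos
    have hr' : Function.Injective (r ∘ Fin.castLE n.le_succ) := hr.comp (Fin.castLE_injective _)
    obtain ⟨h, hh⟩ := exists_smul_triangularFlag hr' b'
    obtain ⟨k, rfl⟩ := blockK.exists_corner_eq h
    have hb'mem : b' ∈ orbitTower n Q := hb' ▸ Set.mem_singleton b'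
    have hcorner := cornerImage_smul_triangularFlag k hr
    rw [← hh] at hcorner
    refine ⟨k • triangularFlag r hr, Set.eq_singleton_iff_unique_mem.2 ⟨fun i h2 hi => ?_,
      fun c hc => ?_⟩, fun x hx => ?_⟩
    · rcases hi.eq_or_lt with rfl | hlt
      · exact ⟨_, hQr ▸ ⟨k, rfl⟩, cornerImage_self _⟩
      · obtain ⟨c, hcQ, hc⟩ := hb'mem i h2 (Nat.lt_succ_iff.1 hlt)
        refine ⟨c, hcQ, ?_⟩
        rw [← cornerImage_cornerImage (Nat.lt_succ_iff.1 hlt), hcorner]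
        exact hc
    · obtain ⟨c', hc'Q, hcc'⟩ := hc (n + 1) (by omega) le_rfl
      rw [cornerImage_self, LieSubalgebra.toSubmodule_inj] at hcc'
      obtain rfl := FlagVariety.ext hcc'
      rw [hQr] at hc'Q
      obtain ⟨l, rfl⟩ := hc'Q
      have hl := cornerImage_smul_triangularFlag l hr
      have hmem : blockK.corner l • triangularFlag _ hr' ∈ orbitTower n Q := by
        intro i h2 hi
        obtain ⟨d, hdQ, hd⟩ := hc i h2 (hi.trans n.le_succ)
        refine ⟨d, hdQ, ?_⟩
        rw [← hd, ← cornerImage_cornerImage hi]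
        exact (congrArg (Submodule.map (cornerProj hi)) hl).symm
      rw [hb', Set.mem_singleton_iff, hh, ← inv_smul_eq_iff, smul_smul,
        smul_triangularFlag_eq_iff] at hmem
      -- Both points lie over `b'`, so the corner of `k⁻¹ l` is triangular; hence so is `k⁻¹ l`, and
      -- the points coincide.
      have hkl : (k.1⁻¹ * l.1).1.BlockTriangular r := by
        rw [blockTriangular_iff_of_commute
          (mem_blockK_iff.1 (mul_mem (inv_mem k.2) l.2)), Units.val_mul,
          cornerProj_mul_of_commute (mem_blockK_iff.1 (inv_mem k.2))]
        exact hmem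
      rw [← smul_triangularFlag_eq_iff hr, mul_smul, inv_smul_eq_iff] at hkl
      exact hkl
    · have hxθ : Commute x (lastSign (n + 1)) := by
        have hxd : x.IsDiag := hx
        rw [← hxd.diagonal_diag]
        exact Matrix.commute_diagonal _ _
      have hkθ := mem_blockK_iff.1 k.2
      have hkiθ := mem_blockK_iff.1 (inv_mem k.2)
      have hx' : cornerProj n.le_succ x ∈ diagonalCartan n := fun a b hab =>
        hx fun hab' => hab (Fin.castLE_injective _ hab')
      have h1 := hdiag hx'
      rw [hh] at h1
      -- For diagonal `x` the matrix `k⁻¹ x k` is block diagonal, so its triangularity can be tested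
      -- on the corner, where `b'` contains the diagonal matrices.
      refine mem_adMap_iff.2 ((blockTriangular_iff_of_commute
        ((hkiθ.mul_left hxθ).mul_left hkθ) r).2 ?_)
      rw [cornerProj_mul_of_commute' hkθ, cornerProj_mul_of_commute hkiθ]
      exact mem_adMap_iff.1 h1

theorem exists_closedOrbitSequence {n : ℕ} {r : Fin n → ℕ} (hr : Function.Injective r) :
    ∃ Q : (i : ℕ) → Set (FlagVariety i), IsClosedOrbitSequence n Q ∧
      triangularFlag r hr ∈ orbitTower n Q := by
  refine ⟨fun i => if h : i ≤ n then MulAction.orbit (blockK i)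
    (triangularFlag (r ∘ Fin.castLE h) (hr.comp (Fin.castLE_injective h))) else ∅,
    fun i _ h => ?_, fun i _ h => ?_⟩
  · simp only [h, dif_pos]
    exact ⟨⟨_, rfl⟩, isClosed_orbit_triangularFlag _⟩
  · simp only [h, dif_pos]
    exact ⟨_, MulAction.mem_orbit_self _, cornerImage_triangularSubalgebra h r⟩

theorem theorem3p8 (n : ℕ) :
    (∀ Q : (i : ℕ) → Set (FlagVariety i), IsClosedOrbitSequence n Q →
      ∃ b : FlagVariety n, orbitTower n Q = {b} ∧ diagonalCartan n ≤ b.carrier) ∧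
    (∀ b : FlagVariety n, diagonalCartan n ≤ b.carrier →
      ∃ Q : (i : ℕ) → Set (FlagVariety i),
        IsClosedOrbitSequence n Q ∧ orbitTower n Q = {b}) := by
  refine ⟨exists_orbitTower_eq_singleton n, fun b hb => ?_⟩
  obtain ⟨r, hr, rfl⟩ := exists_eq_triangularFlag hb
  obtain ⟨Q, hQ, hmem⟩ := exists_closedOrbitSequence hr
  obtain ⟨c, hc, -⟩ := exists_orbitTower_eq_singleton n Q hQ
  refine ⟨Q, hQ, ?_⟩
  rw [hc, Set.mem_singleton_iff] at hmem
  rw [hc, hmem]
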